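/- Let $A$ be a finite alphabet and let $w^r$ denote the reverse of a word $w\in A^*$. View a word $w=a_1\cdots a_n\in A^*$ as the relational structure with universe the set of positions $\{1,\dots,n\}$ (empty if $w=\varepsilon$), with a unary predicate $P_a$ for each letter $a\in A$, true exactly at the positions labelled $a$, and with the binary neighbour predicate $N(x,y)$, true iff $x+1=y$ or $y+1=x$. A language $L\subseteq A^*$ is definable in $\mathrm{FO}(N)$ if there is a first-order sentence $\varphi$ (with equality) over these predicates such that $L=\{w\in A^* : w\models\varphi\}$. For words $w,v\in A^*$ let $\sharp^r(w,v)$ be the number of pairs $(x,y)$ of words with $w=xvy$ or $w=xv^ry$. For $t>0$ and $i,j\in\mathbb N$ write $i=^t j$ if $i=j$ or $i,j\ge t$. For $k,t>0$, words $w,w'\in A^*$ are $(k,t)$-equivalent if either $|w|<k$ and $w'\in\{w,w^r\}$, or the following three conditions hold: 1. $|w|\ge k$ and $|w'|\ge k$; 2. $\sharp^r(w,v)=^t\sharp^r(w',v)$ for all $v\in A^*$ with $|v|\le k$; 3. if $x,x'$ are the prefixes of $w,w'$ of length $k-1$ and $y,y'$ are the suffixes of $w,w'$ of length $k-1$, then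 $\{x,y^r\}=\{x',y'^r\}$. This is an equivalence relation on $A^*$. A language is locally-reversible threshold testable (LRTT) if, for some $k,t>0$, it is a union of $(k,t)$-equivalence classes. **Theorem.** A language $L\subseteq A^*$ is definable in $\mathrm{FO}(N)$ if and only if it is locally-reversible threshold testable. -/

import Mathlib

namespace NeighbourLogic

universe u

/-! ### First-order logic with the neighbour predicate on words -/

/-- The relation symbols of `FO(N)` over the alphabet `A`: a unary predicate `P_a` for every
letter `a`, and the binary neighbour predicate `N`. -/
inductive Rel (A : Type u) : ℕ → Type u
  | letter (a : A) : Rel A 1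
  | nbr : Rel A 2

/-- The relational first-order signature of `FO(N)` over the alphabet `A`. Equality is part of
first-order logic. -/
def signature (A : Type u) : FirstOrder.Language.{0, u} := ⟨fun _ => Empty, Rel A⟩

/-- The word `w` as a relational structure on its set of positions: `P_a` holds at the positions
labelled `a`, and `N(x, y)` holds iff `x + 1 = y` or `y + 1 = x`. -/
@[reducible]
def wordStructure {A : Type u} (w : List A) : (signature A).Structure (Fin w.length) where
  funMap := fun f _ => nomatch f
  RelMap
    | .letter a => fun x => w.get (x 0) = a
    | .nbr => fun x => (x 0 : ℕ) + 1 = (x 1 : ℕ) ∨ (x 1 : ℕ) + 1 = (x 0 : ℕ)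

/-- The word `w` satisfies the `FO(N)` sentence `φ`. -/
def Satisfies {A : Type u} (w : List A) (φ : (signature A).Sentence) : Prop :=
  letI := wordStructure w
  φ.Realize (Fin w.length)

/-- `L` is defined by some sentence of `FO(N)`. -/
def IsDefinable {A : Type u} (L : Language A) : Prop :=
  ∃ φ : (signature A).Sentence, ∀ w : List A, w ∈ L ↔ Satisfies w φ

/-! ### Locally-reversible threshold testable languages -/

/-- The pairs `(x, y)` with `w = x v y` or `w = x vʳ y`. -/
def occurrences {A : Type u} (w v : List A) : Set (List A × List A) :=
  {p | w = p.1 ++ v ++ p.2 ∨ w = p.1 ++ v.reverse ++ p.2}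

/-- There are finitely many such pairs, so that counting them with `Set.ncard` is meaningful. -/
theorem occurrences_finite {A : Type u} (w v : List A) : (occurrences w v).Finite := by
  refine Set.Finite.subset
    ((List.finite_toSet w.inits).prod (List.finite_toSet w.tails)) ?_
  rintro ⟨x, y⟩ h
  refine Set.mem_prod.2 ⟨?_, ?_⟩
  · simp only [Set.mem_ofPred_eq, List.mem_inits]
    rcases h with h | h
    · exact ⟨v ++ y, by simp [h]⟩
    · exact ⟨v.reverse ++ y, by simp [h]⟩
  · simp only [Set.mem_ofPred_eq, List.mem_tails]
    rcases h with h | h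
    · exact ⟨x ++ v, h.symm⟩
    · exact ⟨x ++ v.reverse, h.symm⟩

/-- The number of occurrences of `v` or `vʳ` in `w`. -/
noncomputable def countRev {A : Type u} (w v : List A) : ℕ := (occurrences w v).ncard

/-- Equality of natural numbers with threshold `t`. -/
def EqThreshold (t i j : ℕ) : Prop := i = j ∨ (t ≤ i ∧ t ≤ j)

/-- For the prefix `x` and the suffix `y` of `w` of length `n`, the set `{x, yʳ}`
(used only for words of length at least `n`). -/
def endSet {A : Type u} (n : ℕ) (w : List A) : Set (List A) :=
  {w.take n, (w.drop (w.length - n)).reverse}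

/-- The `(k, t)`-locally-reversible threshold testable equivalence of words. -/
def LRTTEquiv {A : Type u} (k t : ℕ) (w w' : List A) : Prop :=
  (w.length < k ∧ (w' = w ∨ w' = w.reverse)) ∨
  (k ≤ w.length ∧ k ≤ w'.length ∧
    (∀ v : List A, v.length ≤ k → EqThreshold t (countRev w v) (countRev w' v)) ∧
    endSet (k - 1) w = endSet (k - 1) w')

theorem EqThreshold.symm {t i j : ℕ} (h : EqThreshold t i j) : EqThreshold t j i := by
  unfold EqThreshold at *
  omega

theorem EqThreshold.trans {t i j l : ℕ} (h : EqThreshold t i j) (h' : EqThreshold t j l) :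
    EqThreshold t i l := by
  unfold EqThreshold at *
  omega

theorem LRTTEquiv.equivalence {A : Type u} (k t : ℕ) :
    Equivalence (LRTTEquiv (A := A) k t) where
  refl w := by
    rcases lt_or_ge w.length k with h | h
    · exact Or.inl ⟨h, Or.inl rfl⟩
    · exact Or.inr ⟨h, h, fun _ _ => Or.inl rfl, rfl⟩
  symm := by
    rintro w w' (⟨h, rfl | rfl⟩ | ⟨h, h', hc, he⟩)
    · exact Or.inl ⟨h, Or.inl rfl⟩
    · exact Or.inl ⟨by simpa using h, Or.inr (by simp)⟩
    · exact Or.inr ⟨h', h, fun v hv => (hc v hv).symm, he.symm⟩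
  trans := by
    rintro w w' w'' (⟨h, hw⟩ | ⟨h, h', hc, he⟩) (⟨g, gw⟩ | ⟨g, g', gc, ge⟩)
    · refine Or.inl ⟨h, ?_⟩
      rcases hw with rfl | rfl <;> rcases gw with rfl | rfl <;> simp
    · exfalso
      rcases hw with rfl | rfl
      · omega
      · rw [List.length_reverse] at g
        omega
    · omega
    · exact Or.inr ⟨h, g', fun v hv => (hc v hv).trans (gc v hv), he.trans ge⟩

/-- The `(k, t)`-equivalence as a setoid on the set of words over `A`. -/
def lrttSetoid (A : Type u) (k t : ℕ) : Setoid (List A) := ⟨LRTTEquiv k t, LRTTEquiv.equivalence k t⟩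

/-- `L` is locally-reversible threshold testable: for some `k, t > 0` it is a union of
`(k, t)`-equivalence classes. -/
def IsLRTT {A : Type u} (L : Language A) : Prop :=
  ∃ k t : ℕ, 0 < k ∧ 0 < t ∧
    ∃ C : Set (Set (List A)), C ⊆ (lrttSetoid A k t).classes ∧ {w : List A | w ∈ L} = ⋃₀ C

end NeighbourLogic

open FirstOrder

namespace NeighbourLogic

universe u

variable {A : Type u}

attribute [local instance] wordStructure

/-! An occurrence of `v` or `vʳ` in `w` is an injective path of neighbouring positions labelled by
`v`, read in one of the two directions, and an end of `w` is a position with at most one neighbour.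
Both are expressible without orientation, so `m ≤ countRev w v` and membership in `endSet` are
definable (`le_countRev_iff`, `mem_endSet_iff`). For a finite alphabet, finitely many such
properties determine the `(k, t)`-class, so an LRTT language is a finite disjunction of definable
conditions (`IsDefinable.of_finite_separation`).

The converse is an Ehrenfeucht–Fraïssé argument. The state of the game is a finite set of matched
positions, each with a sign telling whether `w'` is read there in the same or in the reversed
direction (`IsMatching`). Each quantifier halves the radius. A new position near a matched one is
answered by the local isometry there. A far one is answered by another occurrence of its surrounding
factor away from all matched positions; the equality of counts up to `t` provides it
(`IsMatching.exists_insert`). The positions just outside the words are matched from the start, which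
is where the condition on prefixes and suffixes enters. Words shorter than `k` are handled by
reversal being an isomorphism. -/

/-- The relation `P` between words and families of positions is defined by a formula of `FO(N)`. -/
def DefinableRel {α : Type*} (P : ∀ w : List A, (α → Fin w.length) → Prop) : Prop :=
  ∃ φ : (signature A).Formula α, ∀ (w : List A) (x : α → Fin w.length), φ.Realize x ↔ P w x

theorem isDefinable_iff_definableRel (L : Language A) :
    IsDefinable L ↔ DefinableRel (α := Empty) fun w _ => w ∈ L := by
  refine exists_congr fun φ => ⟨fun h w x => ?_, fun h w => ?_⟩
  · rw [Subsingleton.elim x default]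
    exact (h w).symm
  · exact (h w default).symm

/-! ### Closure properties of definable relations. -/

namespace DefinableRel

variable {α : Type*} {P Q : ∀ w : List A, (α → Fin w.length) → Prop}

theorem congr (h : DefinableRel P) (hPQ : ∀ w x, P w x ↔ Q w x) : DefinableRel Q :=
  h.imp fun _ hφ w x => (hφ w x).trans (hPQ w x)

theorem not (h : DefinableRel P) : DefinableRel fun w x => ¬ P w x := by
  obtain ⟨φ, hφ⟩ := h
  exact ⟨φ.not, fun w x => by rw [Language.Formula.realize_not, hφ]⟩

theorem and (h : DefinableRel P) (h' : DefinableRel Q) :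
    DefinableRel fun w x => P w x ∧ Q w x := by
  obtain ⟨φ, hφ⟩ := h
  obtain ⟨ψ, hψ⟩ := h'
  exact ⟨φ ⊓ ψ, fun w x => by rw [Language.Formula.realize_inf, hφ, hψ]⟩

theorem imp (h : DefinableRel P) (h' : DefinableRel Q) :
    DefinableRel fun w x => P w x → Q w x :=
  (h.and h'.not).not.congr fun _ _ => by tauto

theorem iff (h : DefinableRel P) (h' : DefinableRel Q) :
    DefinableRel fun w x => (P w x ↔ Q w x) :=
  ((h.imp h').and (h'.imp h)).congr fun _ _ => by tauto

variable (A α) in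
theorem const (p : Prop) :
    DefinableRel fun (w : List A) (_ : α → Fin w.length) => p := by
  by_cases hp : p
  · exact ⟨⊤, fun w x => by simp [hp]⟩
  · exact ⟨⊥, fun w x => by simp [hp]⟩

theorem iInf {ι : Type*} [Finite ι] {P : ι → ∀ w : List A, (α → Fin w.length) → Prop}
    (h : ∀ i, DefinableRel (P i)) : DefinableRel fun w x => ∀ i, P i w x := by
  choose φ hφ using h
  exact ⟨Language.Formula.iInf φ, fun w x => by simp [hφ]⟩

theorem iSup {ι : Type*} [Finite ι] {P : ι → ∀ w : List A, (α → Fin w.length) → Prop}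
    (h : ∀ i, DefinableRel (P i)) : DefinableRel fun w x => ∃ i, P i w x :=
  (iInf fun i => (h i).not).not.congr fun _ _ => by simp

theorem exs {β : Type*} [Finite β]
    {P : ∀ w : List A, (α → Fin w.length) → (β → Fin w.length) → Prop}
    (h : DefinableRel (α := α ⊕ β) fun w z => P w (z ∘ Sum.inl) (z ∘ Sum.inr)) :
    DefinableRel fun w x => ∃ y, P w x y := by
  obtain ⟨φ, hφ⟩ := h
  refine ⟨Language.Formula.iExs β φ, fun w x => ?_⟩
  rw [Language.Formula.realize_iExs]
  exact exists_congr fun y => (hφ w (Sum.elim x y))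

theorem eq (i j : α) : DefinableRel fun (w : List A) (x : α → Fin w.length) => x i = x j :=
  ⟨(Language.Term.var i).equal (Language.Term.var j), fun w x => by
    rw [Language.Formula.realize_equal]; rfl⟩

theorem letter (a : A) (i : α) :
    DefinableRel fun (w : List A) (x : α → Fin w.length) => w.get (x i) = a :=
  let R : (signature A).Relations 1 := Rel.letter a
  ⟨R.formula₁ (Language.Term.var i), fun _ _ => Language.Formula.realize_rel₁.trans Iff.rfl⟩

theorem nbr (i j : α) :
    DefinableRel fun (w : List A) (x : α → Fin w.length) =>
      (x i : ℕ) + 1 = x j ∨ (x j : ℕ) + 1 = x i :=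
  let R : (signature A).Relations 2 := Rel.nbr
  ⟨R.formula₂ (Language.Term.var i) (Language.Term.var j),
    fun _ _ => Language.Formula.realize_rel₂.trans Iff.rfl⟩

end DefinableRel

/-- A language that is determined by finitely many definable properties is definable. -/
theorem IsDefinable.of_finite_separation {ι : Type*} [Finite ι] {L : Language A}
    (P : ι → List A → Prop) (hP : ∀ i, DefinableRel (α := Empty) fun w _ => P i w)
    (h : ∀ w w', (∀ i, P i w ↔ P i w') → w ∈ L → w' ∈ L) : IsDefinable L := by
  rw [isDefinable_iff_definableRel]
  -- `L` is the disjunction, over the finitely many truth patterns `s` realised by a member of `L`,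
  -- of "the pattern of `w` is `s`".
  have key : DefinableRel (α := Empty) fun w _ =>
      ∃ s : Set ι, (∃ w₀ ∈ L, s = {i | P i w₀}) ∧ ∀ i, (P i w ↔ i ∈ s) :=
    DefinableRel.iSup fun s => (DefinableRel.const A Empty _).and <|
      DefinableRel.iInf fun i => (hP i).iff (DefinableRel.const A Empty _)
  refine key.congr fun w _ => ⟨?_, fun hw => ⟨{i | P i w}, ⟨w, hw, rfl⟩, fun i => Iff.rfl⟩⟩
  rintro ⟨_, ⟨w₀, hw₀, rfl⟩, hs⟩
  exact h w₀ w (fun i => (hs i).symm) hw₀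

/-! ### Occurrences as start positions and as labelled paths. -/

/-- `v` can be read in `w` from the position `s` on. -/
def ReadsAt (w v : List A) (s : ℕ) : Prop := ∀ j < v.length, w[s + j]? = v[j]?

theorem ReadsAt.add_length_le {w v : List A} {s : ℕ} (h : ReadsAt w v s) (hv : v ≠ []) :
    s + v.length ≤ w.length := by
  have hpos := List.length_pos_iff.2 hv
  have := h (v.length - 1) (by omega)
  rw [List.getElem?_eq_getElem (l := v) (by omega)] at this
  have := (List.getElem?_eq_some_iff.1 this).1
  omega

theorem readsAt_of_eq_append {w x v y : List A} (h : w = x ++ v ++ y) :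
    ReadsAt w v x.length := by
  intro j hj
  rw [h, List.append_assoc, List.getElem?_append_right (by omega),
    List.getElem?_append_left (by omega)]
  congr 1
  omega

theorem ReadsAt.eq_append {w v : List A} {s : ℕ} (h : ReadsAt w v s) :
    w = w.take s ++ v ++ w.drop (s + v.length) := by
  have hv : v = (w.drop s).take v.length := by
    apply List.ext_getElem?
    intro j
    by_cases hj : j < v.length
    · rw [List.getElem?_take_of_lt hj, List.getElem?_drop, h j hj]
    · rw [List.getElem?_eq_none (by omega), List.getElem?_eq_none (by simp; omega)]
  conv_rhs => enter [1, 2]; rw [hv]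
  rw [List.append_assoc, ← List.drop_drop, List.take_append_drop, List.take_append_drop]

/-- The positions of `w` at which `v` or its reverse begins. -/
def starts (w v : List A) : Set ℕ := {s | ReadsAt w v s ∨ ReadsAt w v.reverse s}

theorem add_length_le_of_mem_starts {w v : List A} {s : ℕ} (h : s ∈ starts w v) (hv : v ≠ []) :
    s + v.length ≤ w.length := by
  rcases h with h | h
  · exact h.add_length_le hv
  · simpa using h.add_length_le (by simpa using hv)

theorem starts_finite (w : List A) {v : List A} (hv : v ≠ []) : (starts w v).Finite :=
  (Set.finite_Iic w.length).subset fun s hs => by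
    have := add_length_le_of_mem_starts hs hv
    simp only [Set.mem_Iic]
    omega

/-- The start determines the pair `(x, y)`, because `v` and its reverse have the same length. A
palindrome is thus counted once at each start. -/
theorem countRev_eq_ncard_starts (w : List A) {v : List A} (hv : v ≠ []) :
    countRev w v = (starts w v).ncard := by
  refine Set.ncard_congr (fun p _ => p.1.length) ?_ ?_ ?_
  · rintro ⟨x, y⟩ (h | h)
    · exact Or.inl (readsAt_of_eq_append h)
    · exact Or.inr (readsAt_of_eq_append h)
  · have aux : ∀ p ∈ occurrences w v,
        p = (w.take p.1.length, w.drop (p.1.length + v.length)) := by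
      rintro ⟨x, y⟩ (h | h)
      · simp [h]
      · simp only at h
        rw [← List.length_reverse (as := v)]
        simp [h]
    intro p q hp hq hpq
    rw [aux p hp, aux q hq]
    simp only [hpq]
  · intro s hs
    have hle := add_length_le_of_mem_starts hs hv
    refine ⟨(w.take s, w.drop (s + v.length)), ?_, by simp; omega⟩
    rcases hs with h | h
    · exact Or.inl h.eq_append
    · refine Or.inr ?_
      have := h.eq_append
      simpa using this

theorem countRev_nil (w : List A) : countRev w [] = w.length + 1 := by
  have : countRev w [] = (Set.Iic w.length).ncard := by
    refine Set.ncard_congr (fun p _ => p.1.length) ?_ ?_ ?_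
    · rintro ⟨x, y⟩ (h | h) <;> simp [h]
    · rintro ⟨x, y⟩ ⟨x', y'⟩ h h' hl
      simp only [occurrences, List.reverse_nil, List.append_nil, or_self,
        Set.mem_ofPred_eq] at h h' hl
      have := List.append_inj (h.symm.trans h') hl
      simp [this.1, this.2]
    · intro s hs
      exact ⟨(w.take s, w.drop s), by simp [occurrences], by simpa using hs⟩
  rw [this, ← Finset.coe_Iic, Set.ncard_coe_finset, Nat.card_Iic]

/-- The positions `p` form a path, in one of the two directions, that is labelled by `v`. -/
def IsOcc (w v : List A) (p : Fin v.length → Fin w.length) : Prop :=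
  (∀ i j, p i = p j → i = j) ∧
  (∀ i j : Fin v.length, (i : ℕ) + 1 = j → ((p i : ℕ) + 1 = p j ∨ (p j : ℕ) + 1 = p i)) ∧
  ∀ j, w.get (p j) = v.get j

/-- An injective walk of natural numbers is monotone. -/
theorem walk_monotone (f : ℕ → ℕ) (n : ℕ) (hinj : ∀ i < n, ∀ j < n, f i = f j → i = j)
    (hnbr : ∀ i, i + 1 < n → f i + 1 = f (i + 1) ∨ f (i + 1) + 1 = f i) :
    (∀ i < n, f i = f 0 + i) ∨ (∀ i < n, f i + i = f 0) := by
  induction n with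
  | zero => simp
  | succ n ih =>
    have ih := ih (fun i hi j hj => hinj i (by omega) j (by omega))
      (fun i hi => hnbr i (by omega))
    rcases n with _ | _ | n
    · left; intro i hi; obtain rfl : i = 0 := by omega
      rfl
    · rcases hnbr 0 (by omega) with h | h
      · left; intro i hi; obtain rfl | rfl : i = 0 ∨ i = 1 := by omega
        · rfl
        · simpa using h.symm
      · right; intro i hi; obtain rfl | rfl : i = 0 ∨ i = 1 := by omega
        · rfl
        · simpa using h
    · have h1 : f (n + 1) + 1 = f (n + 2) ∨ f (n + 2) + 1 = f (n + 1) := hnbr (n + 1) (by omega)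
      -- Turning back would revisit the position two steps earlier, so the direction never changes.
      have hne : f (n + 2) ≠ f n := fun h => by
        have := hinj _ (by omega) _ (by omega) h
        omega
      rcases ih with ih | ih
      · left; intro i hi
        obtain hi | rfl : i < n + 2 ∨ i = n + 2 := by omega
        · exact ih i hi
        · have h2 := ih n (by omega)
          have h3 := ih (n + 1) (by omega)
          change f (n + 2) = f 0 + (n + 2)
          omega
      · right; intro i hi
        obtain hi | rfl : i < n + 2 ∨ i = n + 2 := by omega
        · exact ih i hi
        · have h2 := ih n (by omega)
          have h3 := ih (n + 1) (by omega)
          change f (n + 2) + (n + 2) = f 0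
          omega

theorem IsOcc.exists_start {w v : List A} {p : Fin v.length → Fin w.length} (h : IsOcc w v p)
    (hv : v ≠ []) :
    ∃ s, ((∀ j, (p j : ℕ) = s + j) ∧ ReadsAt w v s) ∨
      ((∀ j, (p j : ℕ) = s + (v.length - 1 - j)) ∧ ReadsAt w v.reverse s) := by
  have hpos := List.length_pos_iff.2 hv
  obtain ⟨hinj, hnbr, hlab⟩ := h
  let f : ℕ → ℕ := fun i => if hi : i < v.length then p ⟨i, hi⟩ else 0
  have hf : ∀ j : Fin v.length, f j = p j := fun j => by simp [f]
  have hlab' : ∀ (j : ℕ) (hj : j < v.length), w[(p ⟨j, hj⟩ : ℕ)]? = v[j]? := fun j hj => by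
    have := hlab ⟨j, hj⟩
    simp only [List.get_eq_getElem] at this
    rw [List.getElem?_eq_getElem hj, List.getElem?_eq_getElem (p ⟨j, hj⟩).2, this]
  rcases walk_monotone f v.length
    (fun i hi j hj hij => by
      have := hinj ⟨i, hi⟩ ⟨j, hj⟩ (Fin.ext (by rw [← hf, ← hf]; exact hij))
      simpa using this)
    (fun i hi => by
      have := hnbr ⟨i, by omega⟩ ⟨i + 1, hi⟩ rfl
      rwa [← hf, ← hf] at this) with h | h
  · have hp : ∀ j, (p j : ℕ) = f 0 + j := fun j => by rw [← hf, h j j.2]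
    refine ⟨f 0, Or.inl ⟨hp, fun j hj => ?_⟩⟩
    rw [← hlab' j hj, hp]
  -- The start of a descending path is its last value; `hlast` shows that the subtraction below is
  -- not truncated.
  · have hlast := h (v.length - 1) (by omega)
    have hp : ∀ j, (p j : ℕ) = (f 0 - (v.length - 1)) + (v.length - 1 - j) := fun j => by
      have := h j j.2
      rw [hf] at this
      omega
    refine ⟨f 0 - (v.length - 1), Or.inr ⟨hp, fun j hj => ?_⟩⟩
    rw [List.length_reverse] at hj
    rw [List.getElem?_reverse hj, ← hlab' (v.length - 1 - j) (by omega), hp]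
    congr 1
    simp only
    omega

theorem ReadsAt.exists_isOcc {w v : List A} {s : ℕ} (h : ReadsAt w v s) (hv : v ≠ []) :
    ∃ p, IsOcc w v p ∧ ∀ j, (p j : ℕ) = s + j := by
  have hle := h.add_length_le hv
  refine ⟨fun j => ⟨s + j, by omega⟩, ⟨?_, ?_, ?_⟩, fun j => rfl⟩
  · intro i j hij
    simp only [Fin.mk.injEq] at hij
    omega
  · intro i j hij
    simp only
    omega
  · intro j
    have := h j j.2
    rw [List.getElem?_eq_getElem (by omega), List.getElem?_eq_getElem j.2] at this
    simpa using this

theorem ReadsAt.exists_isOcc_reverse {w v : List A} {s : ℕ} (h : ReadsAt w v.reverse s)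
    (hv : v ≠ []) :
    ∃ p, IsOcc w v p ∧ ∀ j, (p j : ℕ) = s + (v.length - 1 - j) := by
  have hle := h.add_length_le (by simpa using hv)
  rw [List.length_reverse] at hle
  refine ⟨fun j => ⟨s + (v.length - 1 - j), by omega⟩, ⟨?_, ?_, ?_⟩, fun j => rfl⟩
  · intro i j hij
    simp only [Fin.mk.injEq] at hij
    omega
  · intro i j hij
    simp only
    omega
  · intro j
    have hj : v.length - 1 - j < v.length := by omega
    have := h (v.length - 1 - j) (by simpa using hj)
    rw [List.getElem?_reverse hj, List.getElem?_eq_getElem (by omega),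
      show v.length - 1 - (v.length - 1 - (j : ℕ)) = j by omega,
      List.getElem?_eq_getElem j.2] at this
    simpa using this

/-- A start carries at most two paths, each the reversal of the other. Distinct occurrences are
therefore paths that differ even up to reversal, which needs only equality of positions. -/
theorem le_countRev_iff (w : List A) {v : List A} (hv : v ≠ []) (m : ℕ) :
    m ≤ countRev w v ↔ ∃ p : Fin m × Fin v.length → Fin w.length,
      (∀ i, IsOcc w v fun j => p (i, j)) ∧
      ∀ i i', i ≠ i' → ¬ (∀ j, p (i, j) = p (i', j)) ∧ ¬ ∀ j, p (i, j) = p (i', j.rev) := by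
  have hpos := List.length_pos_iff.2 hv
  rw [countRev_eq_ncard_starts w hv]
  constructor
  · intro hm
    obtain ⟨T, hT, hcard⟩ := Set.exists_subset_card_eq hm
    have hTfin : T.Finite := (starts_finite w hv).subset hT
    have := hTfin.fintype
    have e : Fin m ≃ T := (Fintype.equivFinOfCardEq (by
      rw [← Nat.card_eq_fintype_card, Nat.card_coe_set_eq, hcard])).symm
    have hex : ∀ i : Fin m, ∃ p, IsOcc w v p ∧ ((∀ j, (p j : ℕ) = (e i : ℕ) + j) ∨
        ∀ j, (p j : ℕ) = (e i : ℕ) + (v.length - 1 - j)) := fun i => by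
      rcases hT (e i).2 with h | h
      · obtain ⟨p, hp, hp'⟩ := h.exists_isOcc hv
        exact ⟨p, hp, Or.inl hp'⟩
      · obtain ⟨p, hp, hp'⟩ := h.exists_isOcc_reverse hv
        exact ⟨p, hp, Or.inr hp'⟩
    choose p hp hp' using hex
    refine ⟨fun q => p q.1 q.2, hp, fun i i' hii => ?_⟩
    suffices h : ∀ g : Fin v.length → Fin v.length,
        ((∀ j, g j = j) ∨ ∀ j, g j = j.rev) → ¬ ∀ j, p i j = p i' (g j) from
      ⟨h id (Or.inl fun _ => rfl), h Fin.rev (Or.inr fun _ => rfl)⟩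
    intro g hg heq
    refine hii (e.injective (Subtype.ext ?_))
    -- The sum of the two extreme positions of a path is `2 * s + v.length - 1` in either direction,
    -- so it recovers the start.
    have h0 := congrArg Fin.val (heq ⟨0, hpos⟩)
    have h1 := congrArg Fin.val (heq ⟨v.length - 1, by omega⟩)
    rcases hg with hg | hg <;> rw [hg] at h0 h1 <;>
    rcases hp' i with h | h <;> rcases hp' i' with h' | h' <;> rw [h, h'] at h0 h1 <;>
    simp only [Fin.val_rev] at h0 h1 <;> omega
  · rintro ⟨p, hp, hne⟩
    choose s hs using fun i => (hp i).exists_start hv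
    have hmem : ∀ i, s i ∈ starts w v := fun i => (hs i).imp And.right And.right
    have hinj : Function.Injective s := by
      intro i i' hii
      by_contra hcon
      obtain ⟨h1, h2⟩ := hne i i' hcon
      rcases hs i with ⟨h, -⟩ | ⟨h, -⟩ <;> rcases hs i' with ⟨h', -⟩ | ⟨h', -⟩
      · exact h1 fun j => Fin.ext (by rw [h, h', hii])
      · exact h2 fun j => Fin.ext (by rw [h, h', hii, Fin.val_rev]; omega)
      · exact h2 fun j => Fin.ext (by rw [h, h', hii, Fin.val_rev]; omega)
      · exact h1 fun j => Fin.ext (by rw [h, h', hii])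
    calc m = (Set.range s).ncard := by
          rw [← Nat.card_coe_set_eq, Nat.card_range_of_injective hinj, Nat.card_fin]
      _ ≤ (starts w v).ncard :=
          Set.ncard_le_ncard (Set.range_subset_iff.2 hmem) (starts_finite w hv)

/-! ### Prefixes and suffixes as paths that begin at an end. -/

/-- The position `a` of `w` has at most one neighbour. -/
def IsEnd (w : List A) (a : Fin w.length) : Prop :=
  ∀ b c : Fin w.length, ((a : ℕ) + 1 = b ∨ (b : ℕ) + 1 = a) →
    ((a : ℕ) + 1 = c ∨ (c : ℕ) + 1 = a) → b = c

theorem isEnd_iff (w : List A) (a : Fin w.length) :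
    IsEnd w a ↔ (a : ℕ) = 0 ∨ (a : ℕ) + 1 = w.length := by
  constructor
  · intro h
    by_contra hcon
    have := congrArg Fin.val (h ⟨a - 1, by omega⟩ ⟨a + 1, by omega⟩ (by simp; omega) (by simp))
    simp only at this
    omega
  · intro h b c hb hc
    apply Fin.ext
    omega

theorem mem_endSet_iff (w : List A) {x : List A} (hx : x ≠ []) (hw : x.length ≤ w.length) :
    x ∈ endSet x.length w ↔
      ∃ p, IsOcc w x p ∧ ∀ i : Fin x.length, (i : ℕ) = 0 → IsEnd w (p i) := by
  have hpos := List.length_pos_iff.2 hx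
  have hend : x ∈ endSet x.length w ↔
      ReadsAt w x 0 ∨ ReadsAt w x.reverse (w.length - x.length) := by
    simp only [endSet, Set.mem_insert_iff, Set.mem_singleton_iff]
    refine or_congr ⟨fun h => ?_, fun h => ?_⟩ ⟨fun h => ?_, fun h => ?_⟩
    · exact readsAt_of_eq_append (x := []) (y := w.drop x.length)
        ((List.take_append_drop x.length w).symm.trans (by rw [← h, List.nil_append]))
    · have := h.eq_append
      rw [this]
      simp
    · have := readsAt_of_eq_append (w := w) (x := w.take (w.length - x.length))
        (v := x.reverse) (y := []) (by
          conv_rhs => enter [1, 2]; rw [h]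
          simp)
      rwa [List.length_take, min_eq_left (by omega)] at this
    · have := h.eq_append
      rw [List.length_reverse, Nat.sub_add_cancel hw, List.drop_length, List.append_nil] at this
      have hdrop : w.drop (w.length - x.length) = x.reverse := by
        conv_lhs => enter [2]; rw [this]
        exact List.drop_left' (by simp)
      rw [hdrop, List.reverse_reverse]
  rw [hend]
  constructor
  · rintro (h | h)
    · obtain ⟨p, hp, hp'⟩ := h.exists_isOcc hx
      exact ⟨p, hp, fun i hi => (isEnd_iff _ _).2 (Or.inl (by rw [hp', hi]))⟩
    · obtain ⟨p, hp, hp'⟩ := h.exists_isOcc_reverse hx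
      exact ⟨p, hp, fun i hi => (isEnd_iff _ _).2 (Or.inr (by rw [hp', hi]; omega))⟩
  · rintro ⟨p, hp, hp'⟩
    have h0 := (isEnd_iff _ _).1 (hp' ⟨0, hpos⟩ rfl)
    obtain ⟨s, ⟨h, hr⟩ | ⟨h, hr⟩⟩ := hp.exists_start hx
    · have hs := hr.add_length_le hx
      rw [h] at h0
      simp only [add_zero] at h0
      -- A path that runs away from the wrong end fits into `w` only if it has length one; then both
      -- readings agree.
      rcases h0 with rfl | h0
      · exact Or.inl hr
      · right
        obtain ⟨a, rfl⟩ : ∃ a, x = [a] := List.length_eq_one_iff.1 (by omega)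
        simpa [← h0] using hr
    · have hs := hr.add_length_le (by simpa using hx)
      rw [List.length_reverse] at hs
      rw [h] at h0
      simp only [tsub_zero] at h0
      rcases h0 with h0 | h0
      · left
        obtain ⟨a, rfl⟩ : ∃ a, x = [a] := List.length_eq_one_iff.1 (by omega)
        have : s = 0 := by omega
        simpa [this] using hr
      · right
        rwa [show w.length - x.length = s by omega]

/-! ### Locally-reversible threshold testable languages are definable. -/

theorem isLRTT_iff (L : Language A) :
    IsLRTT L ↔ ∃ k t : ℕ, 0 < k ∧ 0 < t ∧ ∀ w w', LRTTEquiv k t w w' → w ∈ L → w' ∈ L := by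
  refine exists_congr fun k => exists_congr fun t => and_congr_right fun _ =>
    and_congr_right fun _ => ⟨?_, fun h => ?_⟩
  · rintro ⟨C, hC, hL⟩ w w' hww hw
    obtain ⟨c, hc, hwc⟩ : w ∈ ⋃₀ C := hL ▸ hw
    obtain ⟨y, rfl⟩ := hC hc
    have hw' : w' ∈ ⋃₀ C :=
      ⟨_, hc, (LRTTEquiv.equivalence k t).trans ((LRTTEquiv.equivalence k t).symm hww) hwc⟩
    rw [← hL] at hw'
    exact hw'
  · refine ⟨{c | ∃ y ∈ L, c = {x | LRTTEquiv k t x y}}, ?_, ?_⟩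
    · rintro _ ⟨y, -, rfl⟩
      exact ⟨y, rfl⟩
    · ext w
      constructor
      · exact fun hw => ⟨_, ⟨w, hw, rfl⟩, (LRTTEquiv.equivalence k t).refl w⟩
      · rintro ⟨_, ⟨y, hy, rfl⟩, hwy⟩
        exact h y w ((LRTTEquiv.equivalence k t).symm hwy) hy

namespace DefinableRel

theorem isOcc {α : Type*} (v : List A) (f : Fin v.length → α) :
    DefinableRel fun (w : List A) (x : α → Fin w.length) => IsOcc w v fun j => x (f j) := by
  refine .and (iInf fun i => iInf fun j => ?_) (.and (iInf fun i => iInf fun j => ?_)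
    (iInf fun j => letter _ _))
  · exact (eq (f i) (f j)).imp (const A α _)
  · exact (const A α _).imp (nbr (f i) (f j))

theorem le_countRev (v : List A) (m : ℕ) :
    DefinableRel (α := Empty) fun (w : List A) _ => m ≤ countRev w v := by
  rcases eq_or_ne v [] with rfl | hv
  · rcases m with _ | m
    · exact (const A Empty True).congr fun w _ => by simp
    -- The empty word occurs `w.length + 1` times, so `m + 1` occurrences amount to `m` distinct
    -- positions.
    · have h : DefinableRel (α := Empty) fun (w : List A) _ =>
          ∃ p : Fin m → Fin w.length, ∀ i j, p i = p j → i = j :=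
        exs <| iInf fun i => iInf fun j => (eq (Sum.inr i) (Sum.inr j)).imp (const A _ _)
      refine h.congr fun w _ => ?_
      rw [countRev_nil, Nat.add_le_add_iff_right]
      constructor
      · rintro ⟨p, hp⟩
        simpa using Fintype.card_le_of_injective p hp
      · exact fun h => ⟨Fin.castLE h, fun i j hij => Fin.castLE_injective h hij⟩
  · refine .congr ?_ fun w _ => (le_countRev_iff w hv m).symm
    refine exs <| .and (iInf fun i => isOcc v fun j => Sum.inr (i, j)) <|
      iInf fun i => iInf fun i' => (const A _ _).imp <| .and (.not ?_) (.not ?_)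
    · exact iInf fun j => eq (Sum.inr (i, j)) (Sum.inr (i', j))
    · exact iInf fun j => eq (Sum.inr (i, j)) (Sum.inr (i', j.rev))

theorem isEnd {α : Type*} (a : α) :
    DefinableRel fun (w : List A) (x : α → Fin w.length) => IsEnd w (x a) := by
  have h : DefinableRel fun (w : List A) (x : α → Fin w.length) =>
      ∃ y : Fin 2 → Fin w.length, (((x a : ℕ) + 1 = y 0 ∨ (y 0 : ℕ) + 1 = x a) ∧
        ((x a : ℕ) + 1 = y 1 ∨ (y 1 : ℕ) + 1 = x a)) ∧ ¬ y 0 = y 1 :=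
    exs <| .and (.and (nbr (Sum.inl a) (Sum.inr 0)) (nbr (Sum.inl a) (Sum.inr 1)))
      (eq (Sum.inr 0) (Sum.inr 1)).not
  refine h.not.congr fun w x => ⟨fun h b c hb hc => ?_, fun h ⟨y, ⟨hb, hc⟩, hne⟩ => hne (h _ _ hb hc)⟩
  by_contra hbc
  exact h ⟨![b, c], ⟨hb, hc⟩, hbc⟩

theorem exists_isOcc_isEnd (x : List A) :
    DefinableRel (α := Empty) fun (w : List A) _ =>
      ∃ p, IsOcc w x p ∧ ∀ i : Fin x.length, (i : ℕ) = 0 → IsEnd w (p i) :=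
  exs <| .and (isOcc x Sum.inr) <| iInf fun i => (const A _ _).imp (isEnd (Sum.inr i))

end DefinableRel

theorem length_of_mem_endSet {n : ℕ} {w x : List A} (h : x ∈ endSet n w) (hn : n ≤ w.length) :
    x.length = n := by
  rcases h with rfl | rfl
  · simpa using hn
  · simp; omega

theorem eq_or_eq_reverse_of_countRev {w w' : List A} (hl : w'.length = w.length)
    (h : 1 ≤ countRev w' w) : w' = w ∨ w' = w.reverse := by
  obtain ⟨⟨x, y⟩, hp⟩ := Set.nonempty_of_ncard_ne_zero (Nat.one_le_iff_ne_zero.1 h)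
  refine hp.imp (fun h => ?_) fun h => ?_
  all_goals
    simp only at h
    have hlen := congrArg List.length h
    simp only [List.length_append, List.length_reverse] at hlen
    obtain rfl : x = [] := List.length_eq_zero_iff.1 (by omega)
    obtain rfl : y = [] := List.length_eq_zero_iff.1 (by omega)
    simpa using h

theorem one_le_countRev_self (w : List A) : 1 ≤ countRev w w :=
  Nat.one_le_iff_ne_zero.2 <| Set.ncard_ne_zero_of_mem (a := ([], []))
    (Or.inl (by simp)) (occurrences_finite w w)

theorem IsLRTT.isDefinable [Finite A] {L : Language A} (hL : IsLRTT L) : IsDefinable L := by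
  obtain ⟨k, t, hk, -, h⟩ := (isLRTT_iff L).1 hL
  have : Finite {v : List A | v.length ≤ k} := (List.finite_length_le A k).to_subtype
  -- The bound `t + k + 2` serves two purposes: it fixes every count below `t`, and, through the
  -- empty word, every length below `k`.
  let ι := ({v : List A | v.length ≤ k} × Fin (t + k + 2)) ⊕ {v : List A | v.length ≤ k}
  let P : ι → List A → Prop := Sum.elim (fun i w => (i.2 : ℕ) ≤ countRev w i.1)
    fun x w => ∃ p, IsOcc w x p ∧ ∀ i : Fin (x : List A).length, (i : ℕ) = 0 → IsEnd w (p i)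
  refine IsDefinable.of_finite_separation P ?_ fun w w' hP => h w w' ?_
  · rintro (i | x)
    · exact .le_countRev _ _
    · exact .exists_isOcc_isEnd _
  have hcount : ∀ v : List A, v.length ≤ k → ∀ m < t + k + 2,
      (m ≤ countRev w v ↔ m ≤ countRev w' v) :=
    fun v hv m hm => hP (Sum.inl (⟨v, hv⟩, ⟨m, hm⟩))
  have hlen : ∀ m < t + k + 1, (m ≤ w.length ↔ m ≤ w'.length) := fun m hm => by
    have := hcount [] (Nat.zero_le _) (m + 1) (by omega)
    simpa [countRev_nil] using this
  have h₁ := hlen k (by omega)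
  rcases lt_or_ge w.length k with hw | hw
  · refine Or.inl ⟨hw, eq_or_eq_reverse_of_countRev ?_
      ((hcount w hw.le 1 (by omega)).1 (one_le_countRev_self w))⟩
    have h₂ := hlen w.length (by omega)
    have h₃ := hlen (w.length + 1) (by omega)
    omega
  · have hw' := h₁.1 hw
    refine Or.inr ⟨hw, hw', fun v hv => ?_, ?_⟩
    · rcases lt_or_ge (countRev w v) t with hc | hc
      · have h₂ := hcount v hv (countRev w v) (by omega)
        have h₃ := hcount v hv (countRev w v + 1) (by omega)
        exact Or.inl (by omega)
      · exact Or.inr ⟨hc, (hcount v hv t (by omega)).1 hc⟩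
    · have aux : ∀ x : List A, x.length = k - 1 →
          (x ∈ endSet (k - 1) w ↔ x ∈ endSet (k - 1) w') := by
        intro x hx
        rcases eq_or_ne x [] with rfl | hne
        · simp [endSet, ← hx]
        · rw [← hx, mem_endSet_iff w hne (by omega), mem_endSet_iff w' hne (by omega)]
          exact hP (Sum.inr ⟨x, by simp only [Set.mem_ofPred_eq]; omega⟩)
      ext x
      exact ⟨fun h => (aux x (length_of_mem_endSet h (by omega))).1 h,
        fun h => (aux x (length_of_mem_endSet h (by omega))).2 h⟩

/-! ### Matchings, the positions of the game. -/

/-- The letter of `w` at the integer position `z`, if there is one. -/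
def letterAt (w : List A) (z : ℤ) : Option A := if 0 ≤ z then w[z.toNat]? else none

@[simp]
theorem letterAt_natCast (w : List A) (n : ℕ) : letterAt w n = w[n]? := by
  simp [letterAt]

theorem letterAt_eq_none {w : List A} {z : ℤ} (h : z < 0 ∨ (w.length : ℤ) ≤ z) :
    letterAt w z = none := by
  unfold letterAt
  split_ifs with hz
  · exact List.getElem?_eq_none (by omega)
  · rfl

theorem letterAt_eq_none_iff {w : List A} {z : ℤ} :
    letterAt w z = none ↔ z < 0 ∨ (w.length : ℤ) ≤ z := by
  refine ⟨fun h => ?_, letterAt_eq_none⟩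
  by_contra! hz
  rw [letterAt, if_pos hz.1, List.getElem?_eq_none_iff] at h
  omega

/-- The words `w` around `a` and `w'` around `a'` look the same up to distance `r`, when `w'` is
read in the direction given by the sign `e`. -/
def SameView (r : ℕ) (w w' : List A) (a a' e : ℤ) : Prop :=
  ∀ d : ℤ, -r ≤ d → d ≤ r → letterAt w' (a' + e * d) = letterAt w (a + d)

theorem SameView.symm {r : ℕ} {w w' : List A} {a a' e : ℤ} (h : SameView r w w' a a' e)
    (he : e = 1 ∨ e = -1) : SameView r w' w a' a e := by
  intro d h1 h2
  rcases he with rfl | rfl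
  · simpa using (h d h1 h2).symm
  · simpa using (h (-d) (by omega) (by omega)).symm

/-- A ball of radius `r` whose centre is at distance at most `s` lies inside the ball of radius `r +
s`. -/
theorem SameView.shift {r s : ℕ} {w w' : List A} {a a' e b : ℤ}
    (h : SameView (r + s) w w' a a' e) (h1 : -s ≤ b - a) (h2 : b - a ≤ s) :
    SameView r w w' b (a' + e * (b - a)) e := by
  intro d h3 h4
  have := h (b - a + d) (by push_cast; omega) (by push_cast; omega)
  rw [mul_add, ← add_assoc] at this
  rw [this]
  congr 1
  ring

/-- A set of triples `(x, x', e)`, where `x` is a position of `w`, `x'` one of `w'` and `e` a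
sign, is an `r`-matching: the words look the same around matched positions, close positions are
matched to close positions and conversely, and the positions just outside the words are matched. -/
structure IsMatching (r : ℕ) (w w' : List A) (P : Finset (ℤ × ℤ × ℤ)) : Prop where
  sign : ∀ p ∈ P, p.2.2 = 1 ∨ p.2.2 = -1
  view : ∀ p ∈ P, SameView r w w' p.1 p.2.1 p.2.2
  close : ∀ p ∈ P, ∀ q ∈ P, -r ≤ q.1 - p.1 → q.1 - p.1 ≤ r →
    q.2.2 = p.2.2 ∧ q.2.1 - p.2.1 = p.2.2 * (q.1 - p.1)
  close_of_close : ∀ p ∈ P, ∀ q ∈ P, -r ≤ q.2.1 - p.2.1 → q.2.1 - p.2.1 ≤ r →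
    -r ≤ q.1 - p.1 ∧ q.1 - p.1 ≤ r
  left : ∃ p ∈ P, p.1 = -1
  right : ∃ p ∈ P, p.1 = w.length
  left' : ∃ p ∈ P, p.2.1 = -1
  right' : ∃ p ∈ P, p.2.1 = w'.length

/-- Exchange of the two words in a matching. -/
def swapMatching (P : Finset (ℤ × ℤ × ℤ)) : Finset (ℤ × ℤ × ℤ) :=
  P.image fun p => (p.2.1, p.1, p.2.2)

@[simp]
theorem mem_swapMatching {P : Finset (ℤ × ℤ × ℤ)} {a b e : ℤ} :
    (a, b, e) ∈ swapMatching P ↔ (b, a, e) ∈ P := by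
  simp only [swapMatching, Finset.mem_image, Prod.mk.injEq, Prod.exists]
  constructor
  · rintro ⟨_, _, _, h, rfl, rfl, rfl⟩
    exact h
  · exact fun h => ⟨_, _, _, h, rfl, rfl, rfl⟩

theorem card_swapMatching_le (P : Finset (ℤ × ℤ × ℤ)) : (swapMatching P).card ≤ P.card :=
  Finset.card_image_le

theorem swapMatching_insert (P : Finset (ℤ × ℤ × ℤ)) (a b e : ℤ) :
    swapMatching (insert (a, b, e) (swapMatching P)) = insert (b, a, e) P := by
  ext ⟨x, y, z⟩
  simp only [mem_swapMatching, Finset.mem_insert, Prod.mk.injEq]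
  tauto

namespace IsMatching

variable {r : ℕ} {w w' : List A} {P : Finset (ℤ × ℤ × ℤ)}

theorem swap (h : IsMatching r w w' P) : IsMatching r w' w (swapMatching P) := by
  have hclose : ∀ p ∈ P, ∀ q ∈ P, -r ≤ q.2.1 - p.2.1 → q.2.1 - p.2.1 ≤ r →
      q.2.2 = p.2.2 ∧ q.1 - p.1 = p.2.2 * (q.2.1 - p.2.1) := by
    intro p hp q hq h1 h2
    obtain ⟨h3, h4⟩ := h.close_of_close p hp q hq h1 h2
    obtain ⟨h5, h6⟩ := h.close p hp q hq h3 h4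
    refine ⟨h5, ?_⟩
    rcases h.sign p hp with he | he <;> rw [he] at h6 ⊢ <;> omega
  constructor
  · rintro ⟨a, b, e⟩ hp
    exact h.sign (b, a, e) (mem_swapMatching.1 hp)
  · rintro ⟨a, b, e⟩ hp
    rw [mem_swapMatching] at hp
    exact (h.view _ hp).symm (h.sign _ hp)
  · rintro ⟨a, b, e⟩ hp ⟨a', b', e'⟩ hq
    exact hclose _ (mem_swapMatching.1 hp) _ (mem_swapMatching.1 hq)
  · rintro ⟨a, b, e⟩ hp ⟨a', b', e'⟩ hq h1 h2
    rw [mem_swapMatching] at hp hq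
    have h3 := (h.close _ hp _ hq h1 h2).2
    simp only at *
    rcases h.sign _ hp with he | he <;> simp only at he <;> rw [he] at h3 <;> omega
  · obtain ⟨⟨a, b, e⟩, hp, hpa⟩ := h.left'
    exact ⟨(b, a, e), mem_swapMatching.2 hp, hpa⟩
  · obtain ⟨⟨a, b, e⟩, hp, hpa⟩ := h.right'
    exact ⟨(b, a, e), mem_swapMatching.2 hp, hpa⟩
  · obtain ⟨⟨a, b, e⟩, hp, hpa⟩ := h.left
    exact ⟨(b, a, e), mem_swapMatching.2 hp, hpa⟩
  · obtain ⟨⟨a, b, e⟩, hp, hpa⟩ := h.right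
    exact ⟨(b, a, e), mem_swapMatching.2 hp, hpa⟩

theorem mono {s : ℕ} (h : IsMatching r w w' P) (hs : s ≤ r) : IsMatching s w w' P where
  sign := h.sign
  view p hp d h1 h2 := h.view p hp d (by omega) (by omega)
  close p hp q hq h1 h2 := h.close p hp q hq (by omega) (by omega)
  close_of_close p hp q hq h1 h2 := by
    obtain ⟨h3, h4⟩ := h.close_of_close p hp q hq (by omega) (by omega)
    -- At the larger radius the matching preserves distances exactly, so it also preserves the
    -- smaller bound.
    obtain ⟨h5, h6⟩ := h.close p hp q hq h3 h4
    rcases h.sign p hp with he | he <;> rw [he] at h6 <;> omega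
  left := h.left
  right := h.right
  left' := h.left'
  right' := h.right'

theorem insert (h : IsMatching r w w' P) {a a' e : ℤ} (he : e = 1 ∨ e = -1)
    (hv : SameView r w w' a a' e)
    (hc : ∀ p ∈ P, -r ≤ a - p.1 → a - p.1 ≤ r → e = p.2.2 ∧ a' - p.2.1 = p.2.2 * (a - p.1))
    (hc' : ∀ p ∈ P, -r ≤ a' - p.2.1 → a' - p.2.1 ≤ r → -r ≤ a - p.1 ∧ a - p.1 ≤ r) :
    IsMatching r w w' (Insert.insert (a, a', e) P) where
  sign := by
    intro p hp
    obtain rfl | hp := Finset.mem_insert.1 hp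
    exacts [he, h.sign p hp]
  view := by
    intro p hp
    obtain rfl | hp := Finset.mem_insert.1 hp
    exacts [hv, h.view p hp]
  close := by
    intro p hp q hq h1 h2
    obtain rfl | hp := Finset.mem_insert.1 hp <;> obtain rfl | hq := Finset.mem_insert.1 hq
    · simp
    · simp only at h1 h2
      obtain ⟨h3, h4⟩ := hc q hq (by omega) (by omega)
      refine ⟨h3.symm, ?_⟩
      simp only
      rw [h3]
      linear_combination -h4
    · exact hc p hp h1 h2
    · exact h.close p hp q hq h1 h2
  close_of_close := by
    intro p hp q hq h1 h2
    obtain rfl | hp := Finset.mem_insert.1 hp <;> obtain rfl | hq := Finset.mem_insert.1 hq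
    · simp
    · simp only at h1 h2 ⊢
      have := hc' q hq (by omega) (by omega)
      omega
    · exact hc' p hp h1 h2
    · exact h.close_of_close p hp q hq h1 h2
  left := h.left.imp fun _ hp => ⟨Finset.mem_insert_of_mem hp.1, hp.2⟩
  right := h.right.imp fun _ hp => ⟨Finset.mem_insert_of_mem hp.1, hp.2⟩
  left' := h.left'.imp fun _ hp => ⟨Finset.mem_insert_of_mem hp.1, hp.2⟩
  right' := h.right'.imp fun _ hp => ⟨Finset.mem_insert_of_mem hp.1, hp.2⟩

/-- A matching extends to the positions that are close to a matched one. -/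
theorem insert_of_close (h : IsMatching (r + r) w w' P) {a : ℤ} {p : ℤ × ℤ × ℤ} (hp : p ∈ P)
    (h1 : -r ≤ a - p.1) (h2 : a - p.1 ≤ r) :
    IsMatching r w w' (Insert.insert (a, p.2.1 + p.2.2 * (a - p.1), p.2.2) P) := by
  refine (h.mono (by omega)).insert (h.sign p hp) ((h.view p hp).shift h1 h2) ?_ ?_
  · intro q hq h3 h4
    obtain ⟨h5, h6⟩ := h.close p hp q hq (by push_cast; omega) (by push_cast; omega)
    refine ⟨h5.symm, ?_⟩
    rw [h5]
    linear_combination -h6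
  · intro q hq h3 h4
    have hsign := h.sign p hp
    have h7 : -((r + r : ℕ) : ℤ) ≤ q.2.1 - p.2.1 ∧ q.2.1 - p.2.1 ≤ ((r + r : ℕ) : ℤ) := by
      push_cast
      rcases hsign with he | he <;> rw [he] at h3 h4 <;> omega
    obtain ⟨h8, h9⟩ := h.close_of_close p hp q hq h7.1 h7.2
    obtain ⟨h5, h6⟩ := h.close p hp q hq h8 h9
    rcases hsign with he | he <;> rw [he] at h3 h4 h6 <;> omega

end IsMatching

/-! ### Counting views and extending a matching. -/

/-- The positions of `w` around which the letters up to distance `r` are given by `g`, in one of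
the two directions. -/
def centres (r : ℕ) (w : List A) (g : ℤ → Option A) : Set ℤ :=
  {z | (∀ d : ℤ, -r ≤ d → d ≤ r → letterAt w (z + d) = g d) ∨
    ∀ d : ℤ, -r ≤ d → d ≤ r → letterAt w (z + d) = g (-d)}

theorem SameView.mem_centres {r : ℕ} {w w' : List A} {a a' e : ℤ} {g : ℤ → Option A}
    (h : SameView r w w' a a' e) (he : e = 1 ∨ e = -1) (ha : a' ∈ centres r w' g) :
    a ∈ centres r w g := by
  rcases he with rfl | rfl
  · refine ha.imp (fun ha d h1 h2 => ?_) (fun ha d h1 h2 => ?_) <;>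
    rw [← h d h1 h2, one_mul, ha d h1 h2]
  · refine ha.symm.imp (fun ha d h1 h2 => ?_) (fun ha d h1 h2 => ?_) <;>
    simp [← h d h1 h2, ha (-d) (by omega) (by omega)]

theorem readsAt_iff_letterAt {r s : ℕ} {w v : List A} (hv : v.length = 2 * r + 1) :
    ReadsAt w v s ↔
      ∀ d : ℤ, -r ≤ d → d ≤ r → letterAt w ((s + r : ℤ) + d) = letterAt v (r + d) := by
  constructor
  · intro h d h1 h2
    obtain ⟨j, hj⟩ := Int.eq_ofNat_of_zero_le (show 0 ≤ r + d by omega)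
    rw [add_assoc, hj, ← Nat.cast_add, letterAt_natCast, letterAt_natCast]
    exact h j (by omega)
  · intro h j hj
    have := h (j - r) (by omega) (by omega)
    rw [show (s + r : ℤ) + (j - r) = ((s + j : ℕ) : ℤ) by push_cast; ring,
      show (r + (j - r) : ℤ) = (j : ℕ) by ring] at this
    simpa only [letterAt_natCast] using this

theorem letterAt_reverse (v : List A) (z : ℤ) :
    letterAt v.reverse z = letterAt v (v.length - 1 - z) := by
  by_cases hz : 0 ≤ z ∧ z < v.length
  · obtain ⟨j, rfl⟩ := Int.eq_ofNat_of_zero_le hz.1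
    have hj : j < v.length := by omega
    rw [show (v.length - 1 - j : ℤ) = ((v.length - 1 - j : ℕ) : ℤ) by omega, letterAt_natCast,
      letterAt_natCast, List.getElem?_reverse hj]
  · rw [letterAt_eq_none (by rw [List.length_reverse]; omega), letterAt_eq_none (by omega)]

/-- The window described by a word of length `2 * r + 1` contains no `none`, so it lies inside `w`,
and its centre is `r` after its start. -/
theorem centres_eq_image_starts {r : ℕ} {w v : List A} (hv : v.length = 2 * r + 1) :
    centres r w (fun d => letterAt v (r + d)) = (fun s : ℕ => (s + r : ℤ)) '' starts w v := by
  have key : ∀ s : ℕ, s ∈ starts w v ↔ (s + r : ℤ) ∈ centres r w fun d => letterAt v (r + d) := by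
    intro s
    refine or_congr (readsAt_iff_letterAt hv)
      ((readsAt_iff_letterAt (by simpa using hv)).trans ?_)
    refine forall_congr' fun d => ?_
    rw [letterAt_reverse, hv, show ((2 * r + 1 : ℕ) - 1 - (r + d) : ℤ) = r + -d by push_cast; ring]
  ext z
  constructor
  · intro hz
    have hr : (r : ℤ) ≤ z := by
      have hne : letterAt w (z + -r) ≠ none := by
        rcases hz with hz | hz <;> rw [hz (-r) le_rfl (by omega)] <;>
        simp only [ne_eq, letterAt_eq_none_iff] <;> omega
      rw [ne_eq, letterAt_eq_none_iff] at hne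
      omega
    obtain ⟨s, hs⟩ := Int.eq_ofNat_of_zero_le (show 0 ≤ z - r by omega)
    obtain rfl : z = s + r := by omega
    exact ⟨s, (key s).2 hz, rfl⟩
  · rintro ⟨s, hs, rfl⟩
    exact (key s).1 hs

theorem centres_finite {r : ℕ} (w : List A) {v : List A} (hv : v.length = 2 * r + 1) :
    (centres r w fun d => letterAt v (r + d)).Finite := by
  rw [centres_eq_image_starts hv]
  exact (starts_finite w (List.ne_nil_of_length_eq_add_one hv)).image _

theorem ncard_centres {r : ℕ} (w : List A) {v : List A} (hv : v.length = 2 * r + 1) :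
    (centres r w fun d => letterAt v (r + d)).ncard = countRev w v := by
  rw [centres_eq_image_starts hv, Set.ncard_image_of_injective _ fun a b h => by simpa using h,
    countRev_eq_ncard_starts w (List.ne_nil_of_length_eq_add_one hv)]

namespace IsMatching

variable {r : ℕ} {w w' : List A} {P : Finset (ℤ × ℤ × ℤ)}

/-- There are not more occurrences of a view close to matched positions in `w'` than in `w`. -/
theorem ncard_close_le (h : IsMatching (r + r) w w' P) {g : ℤ → Option A}
    (hfin : (centres r w g).Finite) :
    {z ∈ centres r w' g | ∃ p ∈ P, -(r : ℤ) ≤ z - p.2.1 ∧ z - p.2.1 ≤ r}.ncard ≤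
      {z ∈ centres r w g | ∃ p ∈ P, -(r : ℤ) ≤ z - p.1 ∧ z - p.1 ≤ r}.ncard := by
  have hex : ∀ z : ℤ, ∃ p : ℤ × ℤ × ℤ,
      (∃ p ∈ P, -(r : ℤ) ≤ z - p.2.1 ∧ z - p.2.1 ≤ r) →
        p ∈ P ∧ -(r : ℤ) ≤ z - p.2.1 ∧ z - p.2.1 ≤ r := fun z => by
    by_cases hz : ∃ p ∈ P, -(r : ℤ) ≤ z - p.2.1 ∧ z - p.2.1 ≤ r
    · exact hz.imp fun p hp _ => hp
    · exact ⟨(0, 0, 0), fun h => absurd h hz⟩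
  choose p hp using hex
  -- Each centre is carried back by the isometry of a nearby triple. If two images coincide, their
  -- triples are within `2 * r`, hence have the same isometry, and the centres coincide.
  refine Set.ncard_le_ncard_of_injOn (fun z => (p z).1 + (p z).2.2 * (z - (p z).2.1)) ?_ ?_
    (hfin.subset fun z hz => hz.1)
  · rintro z ⟨hz, hzp⟩
    obtain ⟨hpz, h1, h2⟩ := hp z hzp
    have hs := h.sign _ hpz
    refine ⟨?_, p z, hpz, ?_⟩
    · exact ((((h.view _ hpz).symm hs).shift h1 h2).symm hs).mem_centres hs hz
    · rcases hs with hs | hs <;> simp only [hs] <;> omega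
  · rintro z ⟨-, hzp⟩ z' ⟨-, hzp'⟩ heq
    obtain ⟨hpz, h1, h2⟩ := hp z hzp
    obtain ⟨hpz', h1', h2'⟩ := hp z' hzp'
    have hs := h.sign _ hpz
    have hs' := h.sign _ hpz'
    simp only at heq
    obtain ⟨h3, h4⟩ := h.close _ hpz _ hpz'
      (by push_cast; rcases hs with hs | hs <;> rcases hs' with hs' | hs' <;>
          rw [hs, hs'] at heq <;> omega)
      (by push_cast; rcases hs with hs | hs <;> rcases hs' with hs' | hs' <;>
          rw [hs, hs'] at heq <;> omega)
    rw [h3] at heq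
    rcases hs with hs | hs <;> rw [hs] at heq h4 <;> omega

/-- This bounds the centres that the matched positions can block; a count of at least `t` exceeds
it. -/
theorem ncard_close_le_card_mul (P : Finset (ℤ × ℤ × ℤ)) (r : ℕ) (S : Set ℤ) :
    {z ∈ S | ∃ p ∈ P, -(r : ℤ) ≤ z - p.2.1 ∧ z - p.2.1 ≤ r}.ncard ≤ P.card * (2 * r + 1) := by
  have hsub : {z ∈ S | ∃ p ∈ P, -(r : ℤ) ≤ z - p.2.1 ∧ z - p.2.1 ≤ r} ⊆
      (P.biUnion fun p => Finset.Icc (p.2.1 - r) (p.2.1 + r) : Finset ℤ) := by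
    rintro z ⟨-, p, hp, h1, h2⟩
    simp only [Finset.coe_biUnion, Set.mem_iUnion]
    exact ⟨p, hp, by simp only [Finset.coe_Icc, Set.mem_Icc]; omega⟩
  refine (Set.ncard_le_ncard hsub (Finset.finite_toSet _)).trans ?_
  rw [Set.ncard_coe_finset]
  refine Finset.card_biUnion_le_card_mul _ _ _ fun p _ => ?_
  rw [Int.card_Icc]
  omega

/-- The forth property of matchings. -/
theorem exists_insert (h : IsMatching (r + r) w w' P) {t : ℕ}
    (hcount : ∀ v : List A, v.length = 2 * r + 1 → EqThreshold t (countRev w v) (countRev w' v))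
    (ht : P.card * (2 * r + 1) < t) (a : Fin w.length) :
    ∃ (a' : Fin w'.length) (e : ℤ), IsMatching r w w' (Insert.insert ((a : ℤ), (a' : ℤ), e) P) := by
  suffices hsuff : ∃ a' e : ℤ, IsMatching r w w' (Insert.insert ((a : ℤ), a', e) P) by
    obtain ⟨a', e, hm⟩ := hsuff
    have h0 := hm.view _ (Finset.mem_insert_self _ _) 0 (by omega) (by omega)
    simp only [mul_zero, add_zero] at h0
    have hne : letterAt w' a' ≠ none := by
      rw [h0, ne_eq, letterAt_eq_none_iff]
      omega
    rw [ne_eq, letterAt_eq_none_iff] at hne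
    obtain ⟨j, rfl⟩ := Int.eq_ofNat_of_zero_le (show 0 ≤ a' by omega)
    exact ⟨⟨j, by omega⟩, e, hm⟩
  by_cases hnear : ∃ p ∈ P, -(r : ℤ) ≤ a - p.1 ∧ a - p.1 ≤ r
  · obtain ⟨p, hp, h1, h2⟩ := hnear
    exact ⟨_, _, h.insert_of_close hp h1 h2⟩
  have hfar : ∀ p ∈ P, -(r : ℤ) ≤ a - p.1 → a - p.1 ≤ r → False :=
    fun p hp h1 h2 => hnear ⟨p, hp, h1, h2⟩
  obtain ⟨p, hp, hpl⟩ := h.left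
  obtain ⟨q, hq, hqr⟩ := h.right
  -- Being far from the matched positions `-1` and `w.length`, `a` has its whole window inside `w`.
  have hal : r ≤ (a : ℕ) := by
    by_contra hlt
    exact hfar p hp (by omega) (by omega)
  have har : (a : ℕ) + r < w.length := by
    by_contra hlt
    exact hfar q hq (by omega) (by omega)
  let v := (w.drop (a - r)).take (2 * r + 1)
  have hv : v.length = 2 * r + 1 := by simp [v]; omega
  have hread : ReadsAt w v (a - r) := by
    intro j hj
    rw [List.getElem?_take_of_lt (by omega), List.getElem?_drop]
  have hview := (readsAt_iff_letterAt hv).1 hread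
  rw [show (((a : ℕ) - r : ℕ) + r : ℤ) = a by omega] at hview
  set g : ℤ → Option A := fun d => letterAt v (r + d) with hg
  have hex : ∃ z ∈ centres r w' g, ∀ p ∈ P, -(r : ℤ) ≤ z - p.2.1 → z - p.2.1 ≤ r → False := by
    by_contra! hcon
    have heq : {z ∈ centres r w' g | ∃ p ∈ P, -(r : ℤ) ≤ z - p.2.1 ∧ z - p.2.1 ≤ r} =
        centres r w' g := by
      ext z
      refine ⟨fun hz => hz.1, fun hz => ⟨hz, ?_⟩⟩
      obtain ⟨p, hp, h1, h2, -⟩ := hcon z hz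
      exact ⟨p, hp, h1, h2⟩
    have h1 := h.ncard_close_le (g := g) (centres_finite w hv)
    have h2 := ncard_close_le_card_mul P r (centres r w' g)
    rw [heq] at h1 h2
    have h3 : {z ∈ centres r w g | ∃ p ∈ P, -(r : ℤ) ≤ z - p.1 ∧ z - p.1 ≤ r}.ncard <
        (centres r w g).ncard :=
      Set.ncard_lt_ncard ⟨fun z hz => hz.1, fun hsub =>
        hnear (hsub (show (a : ℤ) ∈ centres r w g from Or.inl hview)).2⟩ (centres_finite w hv)
    rw [ncard_centres w hv] at h3
    rw [ncard_centres w' hv] at h1 h2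
    -- If all centres in `w'` were near, their number would be below `t` and also below the number
    -- in `w`, where `a` is a far one. Equality up to `t` excludes this.
    rcases hcount v hv with h4 | h4 <;> omega
  obtain ⟨z, hz, hzfar⟩ := hex
  have hins : ∀ e : ℤ, e = 1 ∨ e = -1 → SameView r w w' a z e →
      IsMatching r w w' (Insert.insert ((a : ℤ), z, e) P) := fun e he hv =>
    (h.mono (by omega)).insert he hv (fun p hp h1 h2 => (hfar p hp h1 h2).elim)
      fun p hp h1 h2 => (hzfar p hp h1 h2).elim
  rcases hz with hz | hz
  · exact ⟨z, 1, hins 1 (Or.inl rfl) fun d h1 h2 => by rw [one_mul, hz d h1 h2, hview d h1 h2]⟩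
  · refine ⟨z, -1, hins (-1) (Or.inr rfl) fun d h1 h2 => ?_⟩
    rw [neg_one_mul, hz (-d) (by omega) (by omega), neg_neg, hview d h1 h2]

end IsMatching

/-! ### The back-and-forth argument. -/

/-- With `q` rounds left the radius is `2 ^ q`; the next move needs windows of length `2 * 2 ^ (q -
1) + 1 = 2 ^ q + 1`. A round adds at most one triple and uses up one unit of `q`, so `P.card + q`
does not grow. Allowing every `q ≥ q₀` gives the two sides of an implication a common `q`. -/
theorem IsMatching.realize_iff {n : ℕ} (φ : (signature A).BoundedFormula Empty n) :
    ∃ q₀, ∀ q ≥ q₀, ∀ (w w' : List A) (t : ℕ) (P : Finset (ℤ × ℤ × ℤ))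
      (x : Fin n → Fin w.length) (x' : Fin n → Fin w'.length),
      IsMatching (2 ^ q) w w' P → (∀ i, ∃ e, ((x i : ℤ), (x' i : ℤ), e) ∈ P) →
      (∀ v : List A, v.length ≤ 2 ^ q + 1 → EqThreshold t (countRev w v) (countRev w' v)) →
      (P.card + q) * (2 ^ q + 1) < t → (φ.Realize default x ↔ φ.Realize default x') := by
  have hone : ∀ q : ℕ, (1 : ℤ) ≤ (2 ^ q : ℕ) := fun q => by exact_mod_cast Nat.one_le_two_pow
  induction φ with
  | falsum => exact ⟨0, fun _ _ _ _ _ _ _ _ _ _ _ _ => Iff.rfl⟩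
  | @equal n t₁ t₂ =>
    refine ⟨0, fun q _ w w' _ P x x' hP hx _ _ => ?_⟩
    rcases t₁ with (i | i) | f
    · exact i.elim
    · rcases t₂ with (j | j) | f
      · exact j.elim
      · obtain ⟨e, hi⟩ := hx i
        obtain ⟨e', hj⟩ := hx j
        have h1 := hP.close _ hi _ hj
        have h2 := hP.swap.close _ (mem_swapMatching.2 hi) _ (mem_swapMatching.2 hj)
        have h3 := hone q
        change x i = x j ↔ x' i = x' j
        rw [Fin.ext_iff, Fin.ext_iff]
        constructor
        · intro h
          have := (h1 (by simp only; omega) (by simp only; omega)).2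
          simp only [h, sub_self, mul_zero] at this
          omega
        · intro h
          have := (h2 (by simp only; omega) (by simp only; omega)).2
          simp only [h, sub_self, mul_zero] at this
          omega
      · exact Empty.elim f
    · exact Empty.elim f
  | @rel n l R ts =>
    refine ⟨0, fun q _ w w' _ P x x' hP hx _ _ => ?_⟩
    have hts : ∀ k, ∃ i, ts k = Language.Term.var (Sum.inr i) := fun k => by
      rcases ts k with (i | i) | f
      · exact i.elim
      · exact ⟨i, rfl⟩
      · exact Empty.elim f
    choose y hy using hts
    obtain rfl : ts = fun k => Language.Term.var (Sum.inr (y k)) := funext hy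
    match l, R with
    | _, .letter a =>
      change w.get (x (y 0)) = a ↔ w'.get (x' (y 0)) = a
      obtain ⟨e, hi⟩ := hx (y 0)
      have h := hP.view _ hi 0 (neg_nonpos.2 (Int.natCast_nonneg _)) (Int.natCast_nonneg _)
      simp only [mul_zero, add_zero, letterAt_natCast] at h
      rw [List.getElem?_eq_getElem (x (y 0)).2, List.getElem?_eq_getElem (x' (y 0)).2,
        Option.some_inj] at h
      simp only [List.get_eq_getElem, h]
    | _, .nbr =>
      change ((x (y 0) : ℕ) + 1 = x (y 1) ∨ (x (y 1) : ℕ) + 1 = x (y 0)) ↔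
        ((x' (y 0) : ℕ) + 1 = x' (y 1) ∨ (x' (y 1) : ℕ) + 1 = x' (y 0))
      obtain ⟨e, hi⟩ := hx (y 0)
      obtain ⟨e', hj⟩ := hx (y 1)
      have h1 := hP.close _ hi _ hj
      have h2 := hP.swap.close _ (mem_swapMatching.2 hi) _ (mem_swapMatching.2 hj)
      have h3 := hone q
      simp only at h1 h2
      have hs := hP.sign _ hi
      simp only at hs
      constructor
      · intro h
        have := (h1 (by omega) (by omega)).2
        rcases hs with rfl | rfl <;> omega
      · intro h
        have := (h2 (by omega) (by omega)).2
        rcases hs with rfl | rfl <;> omega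
  | @imp n φ ψ ihφ ihψ =>
    obtain ⟨q₁, h₁⟩ := ihφ
    obtain ⟨q₂, h₂⟩ := ihψ
    refine ⟨max q₁ q₂, fun q hq w w' t P x x' hP hx hc ht => ?_⟩
    exact imp_congr (h₁ q (le_of_max_le_left hq) w w' t P x x' hP hx hc ht)
      (h₂ q (le_of_max_le_right hq) w w' t P x x' hP hx hc ht)
  | @all n φ ih =>
    obtain ⟨q₀, h₀⟩ := ih
    refine ⟨q₀ + 1, fun q hq w w' t P x x' hP hx hc ht => ?_⟩
    obtain ⟨q, rfl⟩ : ∃ q', q = q' + 1 := ⟨q - 1, by omega⟩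
    have hpow : 2 ^ (q + 1) = 2 ^ q + 2 ^ q := by ring
    have hpos : 0 < 2 ^ q := by positivity
    rw [hpow] at hP
    have hcard : P.card * (2 * 2 ^ q + 1) < t := by
      refine lt_of_le_of_lt ?_ ht
      rw [hpow, ← two_mul]
      exact Nat.mul_le_mul_right _ (by omega)
    have hstep : ∀ (a : Fin w.length) (a' : Fin w'.length) (e : ℤ),
        IsMatching (2 ^ q) w w' (Insert.insert ((a : ℤ), (a' : ℤ), e) P) →
        (φ.Realize default (Fin.snoc x a) ↔ φ.Realize default (Fin.snoc x' a')) := by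
      intro a a' e hm
      refine h₀ q (by omega) w w' t _ _ _ hm (fun i => ?_) (fun v hv => hc v (by omega)) ?_
      · refine Fin.lastCases ?_ (fun i => ?_) i
        · simp only [Fin.snoc_last]
          exact ⟨e, Finset.mem_insert_self _ _⟩
        · simp only [Fin.snoc_castSucc]
          exact (hx i).imp fun _ h => Finset.mem_insert_of_mem h
      · refine lt_of_le_of_lt ?_ ht
        have := Finset.card_insert_le ((a : ℤ), (a' : ℤ), e) P
        exact Nat.mul_le_mul (by omega) (by omega)
    rw [Language.BoundedFormula.realize_all, Language.BoundedFormula.realize_all]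
    constructor
    · intro h a'
      obtain ⟨a, e, hm⟩ := hP.swap.exists_insert (fun v hv => (hc v (by omega)).symm)
        ((Nat.mul_le_mul_right _ (card_swapMatching_le P)).trans_lt hcard) a'
      have hm := hm.swap
      rw [swapMatching_insert] at hm
      exact (hstep a a' e hm).1 (h a)
    · intro h a
      obtain ⟨a', e, hm⟩ := hP.exists_insert (fun v hv => hc v (by omega)) hcard a
      exact (hstep a a' e hm).2 (h a')

/-! ### The initial matching, reversal and the conclusion. -/

/-- A matching of the ends of two words. -/
theorem isMatching_ends {r : ℕ} {w w' : List A} (hw : r < w.length) (hw' : r < w'.length)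
    {a b e : ℤ} (hab : a = -1 ∧ b = w'.length ∧ e = 1 ∨ a = w'.length ∧ b = -1 ∧ e = -1)
    (ha : ∀ j : ℕ, j < r → letterAt w' (a + e * (j + 1)) = letterAt w j)
    (hb : ∀ j : ℕ, j < r → letterAt w' (b - e * (j + 1)) = letterAt w (w.length - 1 - j)) :
    IsMatching r w w' {(-1, a, e), ((w.length : ℤ), b, e)} := by
  have he : e = 1 ∨ e = -1 := by tauto
  constructor
  · simp [he]
  · intro p hp d h1 h2
    simp only [Finset.mem_insert, Finset.mem_singleton] at hp
    rcases hp with rfl | rfl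
    · rcases le_or_gt d 0 with hd | hd
      · rw [letterAt_eq_none (w := w) (by simp only; omega), letterAt_eq_none]
        rcases hab with ⟨rfl, rfl, rfl⟩ | ⟨rfl, rfl, rfl⟩ <;> simp only <;> omega
      · obtain ⟨j, hj⟩ := Int.eq_ofNat_of_zero_le (show 0 ≤ d - 1 by omega)
        obtain rfl : d = j + 1 := by omega
        have := ha j (by omega)
        simp only
        rw [this]
        congr 1
        ring
    · rcases le_or_gt 0 d with hd | hd
      · rw [letterAt_eq_none (w := w) (by simp only; omega), letterAt_eq_none]
        rcases hab with ⟨rfl, rfl, rfl⟩ | ⟨rfl, rfl, rfl⟩ <;> simp only <;> omega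
      · obtain ⟨j, hj⟩ := Int.eq_ofNat_of_zero_le (show 0 ≤ -d - 1 by omega)
        obtain rfl : d = -(j + 1) := by omega
        have := hb j (by omega)
        simp only
        rw [mul_neg, ← sub_eq_add_neg, this]
        congr 1
        ring
  -- The two outer positions are more than `r` apart in both words, so only a triple compared with
  -- itself matters.
  · intro p hp q hq h1 h2
    simp only [Finset.mem_insert, Finset.mem_singleton] at hp hq
    rcases hp with rfl | rfl <;> rcases hq with rfl | rfl <;> simp only at h1 h2 ⊢
    · simp
    · omega
    · omega
    · simp
  · intro p hp q hq h1 h2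
    simp only [Finset.mem_insert, Finset.mem_singleton] at hp hq
    rcases hp with rfl | rfl <;> rcases hq with rfl | rfl <;> simp only at h1 h2 ⊢ <;> omega
  · exact ⟨(-1, a, e), by simp, rfl⟩
  · exact ⟨(w.length, b, e), by simp, rfl⟩
  · rcases hab with ⟨rfl, -, -⟩ | ⟨-, rfl, -⟩
    · exact ⟨(-1, -1, e), by simp, rfl⟩
    · exact ⟨(w.length, -1, e), by simp, rfl⟩
  · rcases hab with ⟨-, rfl, -⟩ | ⟨rfl, -, -⟩
    · exact ⟨(w.length, w'.length, e), by simp, rfl⟩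
    · exact ⟨(-1, w'.length, e), by simp, rfl⟩

theorem getElem?_reverse_drop {w : List A} {r j : ℕ} (hr : r ≤ w.length) (hj : j < r) :
    (w.drop (w.length - r)).reverse[j]? = letterAt w (w.length - 1 - j) := by
  rw [List.getElem?_reverse (by simp; omega), List.getElem?_drop, List.length_drop,
    show (w.length - 1 - j : ℤ) = ((w.length - 1 - j : ℕ) : ℤ) by omega, letterAt_natCast]
  congr 1
  omega

theorem getElem?_take_eq_letterAt {w : List A} {r j : ℕ} (hj : j < r) :
    (w.take r)[j]? = letterAt w j := by
  rw [List.getElem?_take_of_lt hj, letterAt_natCast]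

/-- Words with the same ends, up to reversal, have a matching. -/
theorem exists_isMatching {r : ℕ} {w w' : List A} (hw : r < w.length) (hw' : r < w'.length)
    (h : endSet r w = endSet r w') : ∃ P, IsMatching r w w' P ∧ P.card ≤ 2 := by
  rw [endSet, endSet, Set.pair_eq_pair_iff] at h
  rcases h with ⟨h1, h2⟩ | ⟨h1, h2⟩
  · refine ⟨_, isMatching_ends hw hw' (Or.inl ⟨rfl, rfl, rfl⟩) (fun j hj => ?_) fun j hj => ?_,
      Finset.card_le_two⟩
    · rw [← getElem?_take_eq_letterAt hj, h1, getElem?_take_eq_letterAt hj]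
      congr 1
      ring
    · rw [← getElem?_reverse_drop hw.le hj, h2, getElem?_reverse_drop hw'.le hj]
      congr 1
      ring
  · refine ⟨_, isMatching_ends hw hw' (Or.inr ⟨rfl, rfl, rfl⟩) (fun j hj => ?_) fun j hj => ?_,
      Finset.card_le_two⟩
    · rw [← getElem?_take_eq_letterAt hj, h1, getElem?_reverse_drop hw'.le hj]
      congr 1
      ring
    · rw [← getElem?_reverse_drop hw.le hj, h2, getElem?_take_eq_letterAt hj]
      congr 1
      ring

/-- Reversal of words is an isomorphism of structures. -/
def reverseEquiv (w : List A) :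
    Language.Equiv (signature A) (Fin w.length) (Fin w.reverse.length) where
  toEquiv := Fin.revPerm.trans (finCongr w.length_reverse.symm)
  map_fun' f := nomatch f
  map_rel' {n} R x := by
    match n, R with
    | _, .letter a =>
      change w.reverse.get _ = a ↔ w.get (x 0) = a
      simp only [List.get_eq_getElem, List.getElem_reverse]
      apply Eq.congr_left
      congr 1
      simp
      omega
    | _, .nbr =>
      change (((x 0).rev : ℕ) + 1 = (x 1).rev ∨ ((x 1).rev : ℕ) + 1 = (x 0).rev) ↔
        ((x 0 : ℕ) + 1 = x 1 ∨ (x 1 : ℕ) + 1 = x 0)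
      simp only [Fin.val_rev]
      omega

theorem satisfies_reverse (w : List A) (φ : (signature A).Sentence) :
    Satisfies w.reverse φ ↔ Satisfies w φ :=
  (Language.StrongHomClass.realize_sentence (reverseEquiv w) φ).symm

theorem IsDefinable.isLRTT {L : Language A} (hL : IsDefinable L) : IsLRTT L := by
  obtain ⟨φ, hφ⟩ := hL
  obtain ⟨q, hq⟩ := IsMatching.realize_iff φ
  rw [isLRTT_iff]
  -- Here `k - 1 = 2 ^ q` is the initial radius, `k` the largest window length, and `2` bounds the
  -- size of the initial matching.
  refine ⟨2 ^ q + 1, (2 + q) * (2 ^ q + 1) + 1, Nat.succ_pos _, Nat.succ_pos _, fun w w' hww hw => ?_⟩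
  rw [hφ] at hw ⊢
  rcases hww with ⟨-, rfl | rfl⟩ | ⟨h1, h2, hc, he⟩
  · exact hw
  · exact (satisfies_reverse w φ).2 hw
  · obtain ⟨P, hP, hcard⟩ := exists_isMatching h1 h2 he
    refine (hq q le_rfl w w' _ P default default hP (fun i => i.elim0) hc ?_).1 hw
    exact Nat.lt_succ_of_le (Nat.mul_le_mul_right _ (by omega))

end NeighbourLogic

theorem mainTheorem1 {A : Type*} [Finite A] (L : Language A) :
    NeighbourLogic.IsDefinable L ↔ NeighbourLogic.IsLRTT L :=
  ⟨NeighbourLogic.IsDefinable.isLRTT, NeighbourLogic.IsLRTT.isDefinable⟩
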